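/- Let $d\in\mathbb N$ and let $\Lambda\subset\mathbb R^d$ be a full-rank lattice. Let $f\in L^2(\mathbb R^d)$ (complex valued) with $\|f\|_2\neq 0$. For $\lambda\in\mathbb R^d$ put $T_\lambda f(x)=f(x-\lambda)$, let $\mathcal T^\Lambda(f)=\{T_\lambda f\}_{\lambda\in\Lambda}$, and let $V^\Lambda(f)$ be the closed linear span of $\mathcal T^\Lambda(f)$ in $L^2(\mathbb R^d)$. A family $\{h_i\}_{i\in I}$ in a closed subspace $V$ is called a frame for $V$ if there are constants $0<A\le B<\infty$ with $A\|g\|^2\le\sum_{i\in I}|\langle g,h_i\rangle|^2\le B\|g\|^2$ for all $g\in V$; it is called a Riesz basis for $V$ if it is a minimal frame for $V$, i.e. it is a frame for $V$ but, for every $j\in I$, $\{h_i\}_{i\in I\setminus\{j\}}$ is not a frame for $V$. Suppose that $\mathcal T^\Lambda(f)$ is a frame for $V^\Lambda(f)$ but is not a Riesz basis for $V^\Lambda(f)$. Then $$\int_{\mathbb R^d}|x|\,|f(x)|^2\,dx=\infty ,$$ and $\widehat f\notin H^{1/2}(\mathbb R^d)$. Here $\widehat{\,\cdot\,}$ is the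 Fourier transform on $L^2(\mathbb R^d)$ normalized by $\widehat f(\xi)=\int_{\mathbb R^d} f(x)e^{-2\pi i x\cdot\xi}\,dx$, and $g\in H^{1/2}(\mathbb R^d)$ means $\int_{\mathbb R^d}(1+|\xi|^2)^{1/2}|\widehat g(\xi)|^2\,d\xi<\infty$. -/

import Mathlib

open MeasureTheory

namespace ShiftInvariant

section Frames

variable {H : Type*} [NormedAddCommGroup H] [InnerProductSpace ℂ H] {ι : Type*}

/-- The family `h` (indexed, so that repetitions count) is a frame for the subspace `V` of `H`:
its members lie in `V` and there are `0 < A ≤ B < ∞` such that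
`A ‖g‖² ≤ ∑ i, |⟨g, h i⟩|² ≤ B ‖g‖²` for every `g ∈ V`. -/
def IsFrameFor (h : ι → H) (V : Submodule ℂ H) : Prop :=
  (∀ i, h i ∈ V) ∧
    ∃ A B : ℝ, 0 < A ∧ A ≤ B ∧ ∀ g ∈ V,
      Summable (fun i => ‖inner ℂ (h i) g‖ ^ 2) ∧
      A * ‖g‖ ^ 2 ≤ ∑' i, ‖inner ℂ (h i) g‖ ^ 2 ∧
      ∑' i, ‖inner ℂ (h i) g‖ ^ 2 ≤ B * ‖g‖ ^ 2

/-- The family `h` is a Riesz basis for `V`: it is a minimal frame, i.e. a frame for `V` that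
stops being a frame for `V` as soon as any one of its members is removed. -/
def IsRieszBasisFor (h : ι → H) (V : Submodule ℂ H) : Prop :=
  IsFrameFor h V ∧ ∀ j : ι, ¬ IsFrameFor (fun i : {i : ι // i ≠ j} => h i) V

end Frames

/-- The complex Hilbert space `L²(ℝᵈ)`. -/
abbrev L2 (d : ℕ) : Type := Lp ℂ 2 (volume : Measure (EuclideanSpace ℝ (Fin d)))

/-- The translation operator `T_t f (x) = f (x - t)` on `L²(ℝᵈ)`. -/
noncomputable def translate {d : ℕ} (t : EuclideanSpace ℝ (Fin d)) (f : L2 d) : L2 d :=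
  Lp.compMeasurePreserving (fun x => x - t) (measurePreserving_sub_right volume t) f

/-- The system of translates `{T_l f : l ∈ L}`, as a family indexed by the lattice `L`. -/
noncomputable def translates {d : ℕ} (L : Submodule ℤ (EuclideanSpace ℝ (Fin d))) (f : L2 d) :
    L → L2 d :=
  fun l => translate (l : EuclideanSpace ℝ (Fin d)) f

/-- The closed linear span in `L²(ℝᵈ)` of the translates of `f` along `L`. -/
noncomputable def shiftSpace {d : ℕ} (L : Submodule ℤ (EuclideanSpace ℝ (Fin d))) (f : L2 d) :
    Submodule ℂ (L2 d) :=
  (Submodule.span ℂ (Set.range (translates L f))).topologicalClosure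

end ShiftInvariant

/-!
Let `T n`, `n ∈ ℤᵈ`, be the translations along a basis of the lattice. The correlations
`⟨T n f, f⟩` are square summable by the upper frame bound, hence they are the Fourier coefficients
of a function `φ ∈ L²` on the torus, the spectral density of `f` (`HasSpectralDensity`); it is the
periodization of `|f̂|²`, but neither the dual lattice nor Plancherel's theorem on `ℝᵈ` is needed.
Under `T n f ↦ eₙ` the closed span of the translates becomes `L²(φ)`, so

* the frame bounds say that `φ` takes its values in `{0} ∪ [A, B]` almost everywhere
  (`HasSpectralDensity.ae_eq_zero_or_le`, `HasSpectralDensity.ae_le`);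
* if a frame has a redundant member then `φ` vanishes on a set of positive measure
  (`HasSpectralDensity.not_frame_compl_singleton`).

Let `E = {φ ≥ A}`, which is then neither null nor conull. Multiplication of `f` by
`e^{2πi x·θ}` translates `φ` by `θ`, and comparing the densities of `f`, of the modulated function
and of their difference gives `|E \ (E - θ)| ≤ (2 / A) ‖f - e^{2πi x·θ} f‖²`
(`HasSpectralDensity.mul_measureReal_le`). If `∫ |x| |f|²` were finite, the right-hand side would
be `o(|θ|)` along rays (`tendsto_mul_norm_sub_modulate`). The left-hand side is subadditive in
`θ`, so it would vanish identically; but a set invariant under all translations of the torus is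
null or conull (`measure_eq_zero_or_of_isLittleO`). This is the obstruction to an indicator
function being in `H^{1/2}`.

The statement on `H^{1/2}` is a reformulation, as `f̂ ∈ H^{1/2}` amounts to
`∫ (1 + |x|²)^{1/2} |f(-x)|² dx < ∞` (`lintegral_ne_top_of_memSobolev`).
-/

namespace ShiftInvariant

open UnitAddTorus Filter Topology

/-- Normalised Haar measure on the circle, the measure with respect to which Mathlib states
Fourier analysis on `UnitAddTorus`. -/
noncomputable local instance : MeasureSpace UnitAddCircle := ⟨AddCircle.haarAddCircle⟩

local instance : Measure.IsAddHaarMeasure (volume : Measure UnitAddCircle) :=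
  inferInstanceAs (Measure.IsAddHaarMeasure AddCircle.haarAddCircle)

local instance : IsProbabilityMeasure (volume : Measure UnitAddCircle) :=
  inferInstanceAs (IsProbabilityMeasure AddCircle.haarAddCircle)

/-! ### Trigonometric polynomials and translation-invariant sets on the torus -/

section Torus

variable {ι : Type*} [Fintype ι]

/-- The trigonometric polynomial on the torus with coefficients `c`. -/
noncomputable def trigPoly (c : (ι → ℤ) →₀ ℂ) : C(UnitAddTorus ι, ℂ) :=
  Finsupp.linearCombination ℂ mFourier c

lemma trigPoly_apply (c : (ι → ℤ) →₀ ℂ) (t : UnitAddTorus ι) :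
    trigPoly c t = c.sum fun n a => a * mFourier n t := by
  simp [trigPoly, Finsupp.linearCombination_apply, Finsupp.sum, ContinuousMap.sum_apply]

lemma exists_trigPoly_dist_lt (ψ : C(UnitAddTorus ι, ℂ)) {ε : ℝ} (hε : 0 < ε) :
    ∃ c : (ι → ℤ) →₀ ℂ, ‖ψ - trigPoly c‖ < ε := by
  have h : ψ ∈ (Submodule.span ℂ (Set.range <| mFourier (d := ι))).topologicalClosure := by
    rw [span_mFourier_closure_eq_top]; trivial
  obtain ⟨p, hp, hd⟩ := Metric.mem_closure_iff.1 h ε hε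
  rw [← Finsupp.range_linearCombination] at hp
  obtain ⟨c, rfl⟩ := hp
  exact ⟨c, by rw [← dist_eq_norm]; exact hd⟩

/-- If `∫ |p|² w ≥ 0` for all trigonometric polynomials `p`, then the same holds with `|p|²`
replaced by any nonnegative continuous function, because trigonometric polynomials are uniformly
dense. -/
lemma integral_mul_nonneg_of_trigPoly {w : UnitAddTorus ι → ℝ} (hw : Integrable w)
    (h : ∀ c : (ι → ℤ) →₀ ℂ, 0 ≤ ∫ t, ‖trigPoly c t‖ ^ 2 * w t)
    {ψ : UnitAddTorus ι → ℝ} (hψ : Continuous ψ) (hψ0 : ∀ t, 0 ≤ ψ t) :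
    0 ≤ ∫ t, ψ t * w t := by
  let s : C(UnitAddTorus ι, ℂ) := ⟨fun t => ((Real.sqrt (ψ t) : ℝ) : ℂ), by fun_prop⟩
  have hs : ∀ t, ‖s t‖ ^ 2 = ψ t := fun t => by
    simp [s, Real.sq_sqrt (hψ0 t)]
  choose c hc using fun n : ℕ =>
    exists_trigPoly_dist_lt s (ε := 1 / ((n : ℝ) + 1)) (by positivity)
  have hlim : Tendsto (fun n => trigPoly (c n)) atTop (𝓝 s) := by
    rw [tendsto_iff_norm_sub_tendsto_zero]
    refine squeeze_zero (fun _ => norm_nonneg _) (fun n => ?_)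
      tendsto_one_div_add_atTop_nhds_zero_nat
    rw [norm_sub_rev]
    exact (hc n).le
  have hb : ∀ n, ‖trigPoly (c n)‖ ≤ ‖s‖ + 1 := fun n => by
    have h1 : ‖s - trigPoly (c n)‖ ≤ 1 := by
      refine (hc n).le.trans ?_
      rw [div_le_one (by positivity)]
      linarith [(Nat.cast_nonneg n : (0 : ℝ) ≤ n)]
    have := norm_sub_norm_le (trigPoly (c n)) s
    rw [norm_sub_rev] at this
    linarith
  have key : Tendsto (fun n => ∫ t, ‖trigPoly (c n) t‖ ^ 2 * w t) atTop (𝓝 (∫ t, ψ t * w t)) := by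
    refine tendsto_integral_of_dominated_convergence (fun t => (‖s‖ + 1) ^ 2 * ‖w t‖)
      (fun n => ?_) (hw.norm.const_mul _) (fun n => ?_) ?_
    · exact (Continuous.aestronglyMeasurable (by fun_prop)).mul hw.aestronglyMeasurable
    · refine Eventually.of_forall fun t => ?_
      rw [norm_mul, norm_pow, norm_norm]
      gcongr
      exact ((trigPoly (c n)).norm_coe_le_norm t).trans (hb n)
    · refine Eventually.of_forall fun t => ?_
      rw [← hs t]
      refine Tendsto.mul_const _ (Tendsto.pow (Tendsto.norm ?_) 2)
      exact ((continuous_eval_const t).tendsto s).comp hlim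
  exact ge_of_tendsto' key fun n => h (c n)

/-- A real integrable function `w` on the torus with `∫ |p|² w ≥ 0` for all trigonometric
polynomials `p` is nonnegative almost everywhere. -/
lemma ae_nonneg_of_trigPoly {w : UnitAddTorus ι → ℝ} (hw : Integrable w)
    (h : ∀ c : (ι → ℤ) →₀ ℂ, 0 ≤ ∫ t, ‖trigPoly c t‖ ^ 2 * w t) : ∀ᵐ t, 0 ≤ w t := by
  have hclosed : ∀ K : Set (UnitAddTorus ι), IsClosed K → 0 ≤ ∫ t in K, w t := by
    intro K hK
    obtain ⟨F, hF1, -, hF3⟩ := HasOuterApproxClosed.exAppr K hK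
    have key : Tendsto (fun n => ∫ t, (F n t : ℝ) * w t) atTop
        (𝓝 (∫ t, K.indicator w t)) := by
      refine tendsto_integral_of_dominated_convergence (fun t => ‖w t‖)
        (fun n => ?_) hw.norm (fun n => ?_) ?_
      · refine (Continuous.aestronglyMeasurable ?_).mul hw.aestronglyMeasurable
        exact NNReal.continuous_coe.comp (F n).continuous
      · refine Eventually.of_forall fun t => ?_
        rw [norm_mul]
        have : ‖(F n t : ℝ)‖ ≤ 1 := by
          rw [Real.norm_of_nonneg (F n t).coe_nonneg]
          exact_mod_cast hF1 n t
        exact mul_le_of_le_one_left (norm_nonneg _) this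
      · refine Eventually.of_forall fun t => ?_
        have h1 := tendsto_pi_nhds.1 hF3 t
        have h2 : K.indicator w t = ((K.indicator (fun _ => (1 : NNReal)) t : NNReal) : ℝ) * w t := by
          by_cases ht : t ∈ K <;> simp [ht]
        rw [h2]
        exact ((NNReal.continuous_coe.tendsto _).comp h1).mul_const _
    rw [← integral_indicator hK.measurableSet]
    refine ge_of_tendsto' key fun n => ?_
    exact integral_mul_nonneg_of_trigPoly hw h
      (NNReal.continuous_coe.comp (F n).continuous) fun t => (F n t).coe_nonneg
  -- Inner regularity reduces `{w < 0}` to its closed subsets.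
  wlog hm : Measurable w generalizing w
  · obtain ⟨v, hv, hwv⟩ := hw.aestronglyMeasurable.aemeasurable
    have hvi : Integrable v := hw.congr hwv
    have := this hvi (fun c => ?_) (fun K hK => ?_) hv
    · filter_upwards [this, hwv] with t h1 h2 using h2 ▸ h1
    · refine (h c).trans_eq (integral_congr_ae ?_)
      filter_upwards [hwv] with t ht
      rw [ht]
    · rw [← integral_congr_ae (ae_restrict_of_ae hwv)]
      exact hclosed K hK
  have hS : MeasurableSet {t | w t < 0} := hm measurableSet_Iio
  have h0 : volume {t | w t < 0} = 0 := by
    rw [hS.measure_eq_iSup_isClosed_of_ne_top (measure_ne_top _ _)]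
    simp only [ENNReal.iSup_eq_zero]
    intro K hKs hK
    by_contra hne
    have hneg : ∫ t in K, w t < 0 := by
      have : 0 < ∫ t in K, -w t := by
        rw [setIntegral_pos_iff_support_of_nonneg_ae]
        · refine (pos_iff_ne_zero.2 hne).trans_le (measure_mono fun t ht => ⟨?_, ht⟩)
          have := hKs ht
          simp only [Set.mem_ofPred_eq] at this
          simp [this.ne]
        · filter_upwards [ae_restrict_mem hK.measurableSet] with t ht
          have := hKs ht
          simp only [Set.mem_ofPred_eq] at this
          simp [this.le]
        · exact hw.neg.integrableOn
      rw [integral_neg] at this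
      linarith
    exact absurd (hclosed K hK) (not_le.2 hneg)
  rw [ae_iff]
  simpa only [not_le] using h0

/-- A measurable subset of the torus that is contained, up to null sets, in each of its translates
is null or conull: by Tonelli, `|E| |Eᶜ| = ∫ |{t ∈ E : t + θ ∉ E}| dθ`. -/
lemma measure_eq_zero_or_of_translates {E : Set (UnitAddTorus ι)} (hE : MeasurableSet E)
    (h : ∀ θ : UnitAddTorus ι, volume (E \ (· + θ) ⁻¹' E) = 0) :
    volume E = 0 ∨ volume Eᶜ = 0 := by
  let f : UnitAddTorus ι → UnitAddTorus ι → ENNReal :=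
    fun θ t => E.indicator (fun _ => 1) t * Eᶜ.indicator (fun _ => 1) (t + θ)
  have hmE : Measurable (E.indicator (fun _ => (1 : ENNReal))) := measurable_const.indicator hE
  have hmE' : Measurable (Eᶜ.indicator (fun _ => (1 : ENNReal))) :=
    measurable_const.indicator hE.compl
  have h1 : ∀ θ, ∫⁻ t, f θ t = 0 := fun θ => by
    have : f θ = (E \ (· + θ) ⁻¹' E).indicator fun _ => 1 := by
      funext t
      by_cases h1 : t ∈ E <;> by_cases h2 : t + θ ∈ E <;> simp [f, h1, h2, Set.indicator]
    rw [this, lintegral_indicator (hE.diff (hE.preimage (measurable_add_const θ)))]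
    simp [h θ]
  have h2 : ∀ t, ∫⁻ θ, f θ t = E.indicator (fun _ => 1) t * volume Eᶜ := fun t => by
    simp only [f]
    rw [lintegral_const_mul _ (by exact hmE'.comp (measurable_const_add t)),
      lintegral_add_left_eq_self (fun θ => Eᶜ.indicator (fun _ => (1 : ENNReal)) θ) t,
      lintegral_indicator hE.compl]
    simp
  have h3 : ∫⁻ θ, ∫⁻ t, f θ t = ∫⁻ t, ∫⁻ θ, f θ t := by
    refine lintegral_lintegral_swap (Measurable.aemeasurable ?_)
    exact (hmE.comp measurable_snd).mul (hmE'.comp (measurable_snd.add measurable_fst))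
  simp only [h1, h2, lintegral_zero] at h3
  rw [lintegral_mul_const _ hmE, lintegral_indicator hE] at h3
  simpa using h3.symm

/-- The same with invariance only required up to an error that is `o(|h|)` along rays: the map
`θ ↦ |E \ (E - θ)|` is subadditive, so `|E \ (E - h)| ≤ n |E \ (E - h / n)|` for all `n`. -/
lemma measure_eq_zero_or_of_isLittleO {E : Set (UnitAddTorus ι)} (hE : MeasurableSet E)
    (h : ∀ θ : ι → ℝ, Tendsto (fun n : ℕ => (n : ℝ) *
      volume.real (E \ (· + fun i => ((θ i / n : ℝ) : UnitAddCircle)) ⁻¹' E)) atTop (𝓝 0)) :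
    volume E = 0 ∨ volume Eᶜ = 0 := by
  refine measure_eq_zero_or_of_translates hE fun θ => ?_
  let m : UnitAddTorus ι → ℝ := fun θ => volume.real (E \ (· + θ) ⁻¹' E)
  have hadd : ∀ α β, m (α + β) ≤ m α + m β := fun α β => by
    have hsub : E \ (· + (α + β)) ⁻¹' E ⊆
        (E \ (· + α) ⁻¹' E) ∪ (· + α) ⁻¹' (E \ (· + β) ⁻¹' E) := by
      intro t ht
      by_cases h1 : t + α ∈ E
      · right
        exact ⟨h1, by simpa [add_assoc] using ht.2⟩
      · left
        exact ⟨ht.1, h1⟩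
    refine (measureReal_mono hsub).trans ((measureReal_union_le _ _).trans_eq ?_)
    congr 1
    exact congrArg ENNReal.toReal ((measurePreserving_add_right volume α).measure_preimage
      (hE.diff (hE.preimage (measurable_add_const β))).nullMeasurableSet)
  have hnsmul : ∀ (n : ℕ) α, m (n • α) ≤ n * m α := fun n α => by
    induction n with
    | zero => simp [m]
    | succ n ih =>
      rw [succ_nsmul]
      push_cast
      linarith [hadd (n • α) α]
  choose x hx using fun i => QuotientAddGroup.mk_surjective (θ i)
  have hle : ∀ n : ℕ, 0 < n →
      m θ ≤ n * m (fun i => ((x i / n : ℝ) : UnitAddCircle)) := fun n hn => by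
    have : θ = n • (fun i => ((x i / n : ℝ) : UnitAddCircle) : UnitAddTorus ι) := by
      funext i
      rw [Pi.smul_apply, ← AddCircle.coe_nsmul, nsmul_eq_mul, mul_div_cancel₀ _ (by positivity)]
      exact (hx i).symm
    conv_lhs => rw [this]
    exact hnsmul n _
  have h0 : m θ ≤ 0 := ge_of_tendsto (h x) (eventually_atTop.2 ⟨1, fun n hn => hle n hn⟩)
  have : m θ = 0 := le_antisymm h0 measureReal_nonneg
  simpa [m, measureReal_def, ENNReal.toReal_eq_zero_iff] using this

end Torus

/-! ### Fourier coefficients on the torus -/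

section Density

variable {ι : Type*} [Fintype ι]

lemma hasSum_sq_mFourierCoeff_of_memLp {g : UnitAddTorus ι → ℂ} (hg : MemLp g 2) :
    HasSum (fun n => ‖mFourierCoeff g n‖ ^ 2) (∫ t, ‖g t‖ ^ 2) := by
  have h := hasSum_sq_mFourierCoeff (hg.toLp g)
  have h1 : ∀ n, mFourierCoeff (hg.toLp g) n = mFourierCoeff g n := fun n => by
    refine integral_congr_ae ?_
    filter_upwards [hg.coeFn_toLp] with t ht
    rw [ht]
  have h2 : ∫ t, ‖hg.toLp g t‖ ^ 2 = ∫ t, ‖g t‖ ^ 2 := by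
    refine integral_congr_ae ?_
    filter_upwards [hg.coeFn_toLp] with t ht
    rw [ht]
  simpa only [h1, h2] using h

lemma norm_mFourier_apply (n : ι → ℤ) (t : UnitAddTorus ι) : ‖mFourier n t‖ = 1 := by
  simp only [mFourier, ContinuousMap.coe_mk, norm_prod, fourier_apply, Circle.norm_coe,
    Finset.prod_const_one]

lemma integrable_continuous_mul {g φ : UnitAddTorus ι → ℂ} (hg : Continuous g)
    (hφ : Integrable φ) : Integrable fun t => g t * φ t := by
  obtain ⟨C, hC⟩ := isCompact_univ.exists_bound_of_continuousOn hg.continuousOn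
  exact hφ.bdd_mul hg.aestronglyMeasurable (Eventually.of_forall fun t => hC t trivial)

lemma mFourierCoeff_trigPoly_mul {φ : UnitAddTorus ι → ℂ} (hφ : Integrable φ)
    (c : (ι → ℤ) →₀ ℂ) (n : ι → ℤ) :
    mFourierCoeff (fun t => trigPoly c t * φ t) n =
      c.sum fun m a => a * mFourierCoeff φ (n - m) := by
  simp only [mFourierCoeff, smul_eq_mul, trigPoly_apply, Finsupp.sum, Finset.sum_mul,
    Finset.mul_sum]
  rw [integral_finsetSum]
  · refine Finset.sum_congr rfl fun m _ => ?_
    rw [← integral_const_mul]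
    refine integral_congr_ae (Eventually.of_forall fun t => ?_)
    simp only
    rw [show -(n - m) = -n + m by abel, mFourier_add]
    ring
  · intro m _
    refine (integrable_continuous_mul (g := fun t => mFourier (-n) t * (c m * mFourier m t))
      (by fun_prop) hφ).congr (Eventually.of_forall fun t => ?_)
    simp only
    ring

lemma integral_norm_sq_trigPoly_mul {φ : UnitAddTorus ι → ℂ} (hφ : Integrable φ)
    (c : (ι → ℤ) →₀ ℂ) :
    ∫ t, ((‖trigPoly c t‖ ^ 2 : ℝ) : ℂ) * φ t =
      c.sum fun n a => starRingEnd ℂ a * mFourierCoeff (fun t => trigPoly c t * φ t) n := by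
  have h : ∀ t, ((‖trigPoly c t‖ ^ 2 : ℝ) : ℂ) * φ t =
      ∑ n ∈ c.support, starRingEnd ℂ (c n) * (mFourier (-n) t * (trigPoly c t * φ t)) := by
    intro t
    have h1 : starRingEnd ℂ (trigPoly c t) =
        ∑ n ∈ c.support, starRingEnd ℂ (c n) * mFourier (-n) t := by
      rw [trigPoly_apply, Finsupp.sum, map_sum]
      simp only [map_mul, mFourier_neg]
    have h2 : ((‖trigPoly c t‖ ^ 2 : ℝ) : ℂ) = starRingEnd ℂ (trigPoly c t) * trigPoly c t := by
      rw [Complex.conj_mul']; norm_cast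
    rw [h2, h1, mul_assoc, Finset.sum_mul]
    simp only [mul_assoc]
  simp only [h, Finsupp.sum, mFourierCoeff, smul_eq_mul]
  rw [integral_finsetSum]
  · exact Finset.sum_congr rfl fun n _ => integral_const_mul _ _
  · intro n _
    refine ((integrable_continuous_mul (g := fun t => mFourier (-n) t * trigPoly c t)
      (by fun_prop) hφ).const_mul (starRingEnd ℂ (c n))).congr (Eventually.of_forall fun t => ?_)
    simp only [mul_assoc]

lemma mFourierCoeff_conj (φ : UnitAddTorus ι → ℂ) (n : ι → ℤ) :
    mFourierCoeff (fun t => starRingEnd ℂ (φ t)) n = starRingEnd ℂ (mFourierCoeff φ (-n)) := by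
  simp only [mFourierCoeff, smul_eq_mul]
  rw [← integral_conj, neg_neg]
  simp only [map_mul, mFourier_neg]

lemma mFourierCoeff_add_right (φ : UnitAddTorus ι → ℂ) (θ : UnitAddTorus ι) (n : ι → ℤ) :
    mFourierCoeff (fun t => φ (t + θ)) n = mFourier n θ * mFourierCoeff φ n := by
  simp only [mFourierCoeff, smul_eq_mul]
  rw [← integral_const_mul,
    ← integral_add_right_eq_self (fun t => mFourier n θ * (mFourier (-n) t * φ t)) θ]
  refine integral_congr_ae (Eventually.of_forall fun t => ?_)
  have h : mFourier n θ * mFourier (-n) (t + θ) = mFourier (-n) t := by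
    have h1 : mFourier (-n) (t + θ) = mFourier (-n) t * mFourier (-n) θ := by
      simp only [mFourier, ContinuousMap.coe_mk, Pi.add_apply, fourier_apply, smul_add,
        AddCircle.toCircle_add, Circle.coe_mul, Finset.prod_mul_distrib]
    rw [h1, mul_left_comm, ← mFourier_add, add_neg_cancel, mFourier_zero]
    simp
  simp only
  rw [← mul_assoc, h]

end Density

/-! ### Spectral densities -/

section Shift

variable {ι : Type*} [Fintype ι] {H : Type*} [NormedAddCommGroup H] [InnerProductSpace ℂ H]

/-- The operators `T n`, `n ∈ ℤᵈ`, behave like a unitary representation of `ℤᵈ`. Only the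
consequence for inner products of the orbits is recorded. -/
structure IsShift (T : (ι → ℤ) → H →ₗ[ℂ] H) : Prop where
  zero_apply : ∀ x, T 0 x = x
  inner_apply : ∀ m n x y, inner ℂ (T m x) (T n y) = inner ℂ (T (m - n) x) y

/-- The finite linear combination `∑ c n • T n x` of the orbit of `x`. -/
noncomputable def synth (T : (ι → ℤ) → H →ₗ[ℂ] H) (x : H) (c : (ι → ℤ) →₀ ℂ) : H :=
  Finsupp.linearCombination ℂ (fun n => T n x) c

/-- The function `φ` on the torus is the density of the spectral measure of the pair `x, y`:
its Fourier coefficients are the correlations `⟨T n x, y⟩`. For translations along a lattice and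
`x = y = f` this is the periodization of `|f̂|²`. -/
structure HasSpectralDensity (T : (ι → ℤ) → H →ₗ[ℂ] H) (x y : H) (φ : UnitAddTorus ι → ℂ) :
    Prop where
  integrable : Integrable φ
  coeff : ∀ n, mFourierCoeff φ n = inner ℂ (T n x) y

variable {T : (ι → ℤ) → H →ₗ[ℂ] H} {x y : H} {φ : UnitAddTorus ι → ℂ}

lemma exists_hasSpectralDensity (h : Summable fun n => ‖inner ℂ (T n x) y‖ ^ 2) :
    ∃ φ, Measurable φ ∧ MemLp φ 2 ∧ HasSpectralDensity T x y φ := by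
  have ha : Memℓp (fun n => inner ℂ (T n x) y) 2 := by
    rw [memℓp_gen_iff (by simp)]
    simpa using h
  let g := (mFourierBasis (d := ι)).repr.symm ⟨_, ha⟩
  refine ⟨g, (Lp.stronglyMeasurable g).measurable, Lp.memLp g,
    (Lp.memLp g).integrable (by norm_num), fun n => ?_⟩
  rw [← mFourierBasis_repr]
  simp [g]

namespace HasSpectralDensity

lemma inner_synth (hT : IsShift T) (h : HasSpectralDensity T x y φ) (c : (ι → ℤ) →₀ ℂ)
    (n : ι → ℤ) :
    inner ℂ (T n x) (synth T y c) = mFourierCoeff (fun t => trigPoly c t * φ t) n := by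
  rw [mFourierCoeff_trigPoly_mul h.integrable, synth, Finsupp.linearCombination_apply,
    Finsupp.sum, inner_sum]
  refine Finset.sum_congr rfl fun m _ => ?_
  rw [inner_smul_right, hT.inner_apply, ← h.coeff]

lemma integral_norm_sq_mul (hT : IsShift T) (h : HasSpectralDensity T x y φ)
    (c : (ι → ℤ) →₀ ℂ) :
    ∫ t, ((‖trigPoly c t‖ ^ 2 : ℝ) : ℂ) * φ t = inner ℂ (synth T x c) (synth T y c) := by
  rw [integral_norm_sq_trigPoly_mul h.integrable]
  conv_rhs => rw [synth, Finsupp.linearCombination_apply, Finsupp.sum, sum_inner]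
  refine Finset.sum_congr rfl fun n _ => ?_
  rw [inner_smul_left, h.inner_synth hT]

lemma integral_eq (hT : IsShift T) (h : HasSpectralDensity T x y φ) :
    ∫ t, φ t = inner ℂ x y := by
  have := h.coeff 0
  rw [hT.zero_apply] at this
  simpa [mFourierCoeff, mFourier_zero] using this

lemma integral_norm_sq_mul_re (hT : IsShift T) (h : HasSpectralDensity T x x φ)
    (c : (ι → ℤ) →₀ ℂ) :
    ∫ t, ‖trigPoly c t‖ ^ 2 * (φ t).re = ‖synth T x c‖ ^ 2 := by
  have h1 := congrArg RCLike.re (h.integral_norm_sq_mul hT c)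
  rw [← integral_re (integrable_continuous_mul (by fun_prop) h.integrable),
    inner_self_eq_norm_sq] at h1
  simpa only [RCLike.re_to_complex, Complex.re_ofReal_mul] using h1

lemma integral_norm_sq_mul_im (hT : IsShift T) (h : HasSpectralDensity T x x φ)
    (c : (ι → ℤ) →₀ ℂ) :
    ∫ t, ‖trigPoly c t‖ ^ 2 * (φ t).im = 0 := by
  have h1 := congrArg RCLike.im (h.integral_norm_sq_mul hT c)
  rw [← integral_im (integrable_continuous_mul (by fun_prop) h.integrable),
    inner_self_im] at h1
  simpa only [RCLike.im_to_complex, Complex.im_ofReal_mul] using h1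

/-- The spectral density of a single vector is nonnegative, since `∫ |p|² φ` is the squared norm
of a linear combination of the orbit for every trigonometric polynomial `p`. -/
lemma ae_nonneg (hT : IsShift T) (h : HasSpectralDensity T x x φ) :
    ∀ᵐ t, φ t = ((φ t).re : ℂ) ∧ 0 ≤ (φ t).re := by
  have h1 : ∀ᵐ t, 0 ≤ (φ t).re := ae_nonneg_of_trigPoly h.integrable.re fun c => by
    exact (h.integral_norm_sq_mul_re hT c).symm ▸ sq_nonneg _
  have h2 : ∀ᵐ t, 0 ≤ (φ t).im := ae_nonneg_of_trigPoly h.integrable.im fun c => by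
    exact (h.integral_norm_sq_mul_im hT c).ge
  have h3 : ∀ᵐ t, 0 ≤ -(φ t).im := ae_nonneg_of_trigPoly h.integrable.im.neg fun c => by
    simp only [mul_neg]
    rw [integral_neg]
    exact (neg_eq_zero.2 (h.integral_norm_sq_mul_im hT c)).ge
  filter_upwards [h1, h2, h3] with t h1 h2 h3
  refine ⟨Complex.ext (by simp) ?_, h1⟩
  simp only [Complex.ofReal_im]
  linarith

lemma memLp_trigPoly_mul (h2 : MemLp φ 2) (c : (ι → ℤ) →₀ ℂ) :
    MemLp (fun t => trigPoly c t * φ t) 2 := by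
  refine (h2.const_mul ((‖trigPoly c‖ : ℝ) : ℂ)).mono
    ((map_continuous (trigPoly c)).aestronglyMeasurable.mul h2.aestronglyMeasurable)
    (Eventually.of_forall fun t => ?_)
  simp only [norm_mul, Complex.norm_real, norm_norm]
  gcongr
  exact (trigPoly c).norm_coe_le_norm t

lemma hasSum_sq_inner_synth (hT : IsShift T) (h : HasSpectralDensity T x y φ) (h2 : MemLp φ 2)
    (c : (ι → ℤ) →₀ ℂ) :
    HasSum (fun n => ‖inner ℂ (T n x) (synth T y c)‖ ^ 2)
      (∫ t, ‖trigPoly c t‖ ^ 2 * ‖φ t‖ ^ 2) := by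
  have := hasSum_sq_mFourierCoeff_of_memLp (memLp_trigPoly_mul h2 c)
  simp only [norm_mul, mul_pow] at this
  simpa only [h.inner_synth hT] using this

lemma ae_norm_sq_eq (hT : IsShift T) (h : HasSpectralDensity T x x φ) :
    ∀ᵐ t, ‖φ t‖ ^ 2 = (φ t).re ^ 2 := by
  filter_upwards [h.ae_nonneg hT] with t ht
  rw [ht.1]
  simp

/-- A lower frame bound `A` on the linear combinations of the orbit of `x` forces the spectral
density to avoid the interval `(0, A)`: integrated against `|p|²`, the frame inequality reads
`A ∫ |p|² φ ≤ ∫ |p|² φ²`. -/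
lemma ae_eq_zero_or_le (hT : IsShift T) (h : HasSpectralDensity T x x φ) (h2 : MemLp φ 2) {A : ℝ}
    (hA : ∀ c, A * ‖synth T x c‖ ^ 2 ≤ ∑' n, ‖inner ℂ (T n x) (synth T x c)‖ ^ 2) :
    ∀ᵐ t, (φ t).re = 0 ∨ A ≤ (φ t).re := by
  have hi : Integrable fun t => ‖φ t‖ ^ 2 := h2.integrable_norm_pow (by norm_num)
  have key : ∀ᵐ t, 0 ≤ ‖φ t‖ ^ 2 - A * (φ t).re := by
    refine ae_nonneg_of_trigPoly (hi.sub (h.integrable.re.const_mul A)) fun c => ?_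
    have h3 := hA c
    rw [(h.hasSum_sq_inner_synth hT h2 c).tsum_eq, ← h.integral_norm_sq_mul_re hT c] at h3
    have e : ∀ t, ‖trigPoly c t‖ ^ 2 * (‖φ t‖ ^ 2 - A * (φ t).re) =
        ‖trigPoly c t‖ ^ 2 * ‖φ t‖ ^ 2 - A * (‖trigPoly c t‖ ^ 2 * (φ t).re) := fun t => by ring
    simp only [e]
    rw [integral_sub, integral_const_mul]
    · linarith
    · have := (memLp_trigPoly_mul h2 c).integrable_norm_pow (by norm_num)
      simpa only [norm_mul, mul_pow] using this
    · refine Integrable.const_mul ?_ A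
      have := (integrable_continuous_mul (g := fun t => ((‖trigPoly c t‖ ^ 2 : ℝ) : ℂ))
        (by fun_prop) h.integrable).re
      simpa only [RCLike.re_to_complex, Complex.re_ofReal_mul] using this
  filter_upwards [key, h.ae_nonneg hT, h.ae_norm_sq_eq hT] with t h4 h5 h6
  rw [h6] at h4
  rcases h5.2.eq_or_lt with h7 | h7
  · exact Or.inl h7.symm
  · right
    by_contra! h8
    nlinarith

/-- An upper frame bound `B` bounds the spectral density. -/
lemma ae_le (hT : IsShift T) (h : HasSpectralDensity T x x φ) (h2 : MemLp φ 2) {B : ℝ}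
    (hB0 : 0 ≤ B)
    (hB : ∀ c, ∑' n, ‖inner ℂ (T n x) (synth T x c)‖ ^ 2 ≤ B * ‖synth T x c‖ ^ 2) :
    ∀ᵐ t, (φ t).re ≤ B := by
  have hi : Integrable fun t => ‖φ t‖ ^ 2 := h2.integrable_norm_pow (by norm_num)
  have key : ∀ᵐ t, 0 ≤ B * (φ t).re - ‖φ t‖ ^ 2 := by
    refine ae_nonneg_of_trigPoly ((h.integrable.re.const_mul B).sub hi) fun c => ?_
    have h3 := hB c
    rw [(h.hasSum_sq_inner_synth hT h2 c).tsum_eq, ← h.integral_norm_sq_mul_re hT c] at h3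
    have e : ∀ t, ‖trigPoly c t‖ ^ 2 * (B * (φ t).re - ‖φ t‖ ^ 2) =
        B * (‖trigPoly c t‖ ^ 2 * (φ t).re) - ‖trigPoly c t‖ ^ 2 * ‖φ t‖ ^ 2 := fun t => by ring
    simp only [e]
    rw [integral_sub, integral_const_mul]
    · linarith
    · refine Integrable.const_mul ?_ B
      have := (integrable_continuous_mul (g := fun t => ((‖trigPoly c t‖ ^ 2 : ℝ) : ℂ))
        (by fun_prop) h.integrable).re
      simpa only [RCLike.re_to_complex, Complex.re_ofReal_mul] using this
    · have := (memLp_trigPoly_mul h2 c).integrable_norm_pow (by norm_num)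
      simpa only [norm_mul, mul_pow] using this
  filter_upwards [key, h.ae_nonneg hT, h.ae_norm_sq_eq hT] with t h4 h5 h6
  rw [h6] at h4
  by_contra! h8
  nlinarith

end HasSpectralDensity

end Shift

/-! ### Redundancy and perturbation of the generator -/

section Perturbation

variable {ι : Type*} [Fintype ι] {H : Type*} [NormedAddCommGroup H] [InnerProductSpace ℂ H]
  {T : (ι → ℤ) → H →ₗ[ℂ] H} {x y : H} {φ χ ω : UnitAddTorus ι → ℂ}

lemma norm_sq_toLp {α : Type*} [MeasurableSpace α] {μ : Measure α} {g : α → ℂ}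
    (hg : MemLp g 2 μ) : ‖hg.toLp g‖ ^ 2 = ∫ t, ‖g t‖ ^ 2 ∂μ := by
  have h := congrArg RCLike.re (L2.inner_def (𝕜 := ℂ) (hg.toLp g) (hg.toLp g))
  rw [inner_self_eq_norm_sq, ← integral_re (L2.integrable_inner _ _)] at h
  rw [h]
  refine integral_congr_ae ?_
  filter_upwards [hg.coeFn_toLp] with t ht
  rw [ht, inner_self_eq_norm_sq]

lemma mFourierCoeff_mFourier_of_ne {n j : ι → ℤ} (hn : n ≠ j) :
    mFourierCoeff (mFourier j) n = 0 := by
  rw [← mFourierCoeff_toLp, ← mFourierBasis_repr, HilbertBasis.repr_apply_apply,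
    coe_mFourierBasis]
  exact orthonormal_mFourier.2 hn

namespace HasSpectralDensity

/-- If the spectral density `φ` of `x` is bounded above and below, then no member of the orbit of
`x` is redundant. Otherwise `‖p‖² ≲ ‖p φ - eⱼ‖² ≲ ‖p - eⱼ / φ‖²` for every trigonometric
polynomial `p`, where `eⱼ` is the `j`-th monomial; by density this extends to `p = eⱼ / φ`, which
is absurd. -/
lemma not_frame_compl_singleton (hT : IsShift T) (h : HasSpectralDensity T x x φ)
    (h2 : MemLp φ 2) {A B A' : ℝ} (hA : 0 < A) (hA' : 0 < A') (hge : ∀ᵐ t, A ≤ (φ t).re)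
    (hle : ∀ᵐ t, (φ t).re ≤ B) (j : ι → ℤ) :
    ¬ ∀ c, A' * ‖synth T x c‖ ^ 2 ≤
      ∑' n : {n // n ≠ j}, ‖inner ℂ (T n x) (synth T x c)‖ ^ 2 := by
  intro hfr
  have hnorm : ∀ᵐ t, A ≤ ‖φ t‖ ∧ ‖φ t‖ ≤ B := by
    filter_upwards [hge, hle, h.ae_nonneg hT] with t h3 h4 h5
    rw [h5.1, Complex.norm_real, Real.norm_of_nonneg h5.2]
    exact ⟨h3, h4⟩
  let ψ : UnitAddTorus ι → ℂ := fun t => mFourier j t * (φ t)⁻¹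
  have hψ : MemLp ψ 2 := by
    refine MemLp.of_bound ((map_continuous (mFourier j)).aestronglyMeasurable.mul
      h2.aestronglyMeasurable.aemeasurable.inv.aestronglyMeasurable) A⁻¹ ?_
    filter_upwards [hnorm] with t ht
    rw [norm_mul, norm_mFourier_apply, one_mul, norm_inv]
    exact inv_anti₀ hA ht.1
  have hp : ∀ c : (ι → ℤ) →₀ ℂ, MemLp (fun t => trigPoly c t) 2 := fun c =>
    (map_continuous (trigPoly c)).memLp_of_hasCompactSupport (HasCompactSupport.of_compactSpace _)
  have key : ∀ c : (ι → ℤ) →₀ ℂ,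
      A' * A * ‖(hp c).toLp‖ ^ 2 ≤ B ^ 2 * ‖(hp c).toLp - hψ.toLp‖ ^ 2 := by
    intro c
    have hm : MemLp (fun t => trigPoly c t * φ t - mFourier j t) 2 :=
      (memLp_trigPoly_mul h2 c).sub
        ((map_continuous (mFourier j)).memLp_of_hasCompactSupport
          (HasCompactSupport.of_compactSpace _))
    have hs := hasSum_sq_mFourierCoeff_of_memLp hm
    have hcoeff : ∀ n : {n // n ≠ j},
        mFourierCoeff (fun t => trigPoly c t * φ t - mFourier j t) n.1 =
          inner ℂ (T n x) (synth T x c) := by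
      intro n
      rw [h.inner_synth hT]
      have h3 := mFourierCoeff_mFourier_of_ne n.2
      simp only [mFourierCoeff, smul_eq_mul, mul_sub] at h3 ⊢
      rw [integral_sub (integrable_continuous_mul (map_continuous (mFourier (-n.1)))
          (integrable_continuous_mul (map_continuous (trigPoly c)) h.integrable))
        (integrable_continuous_mul (map_continuous (mFourier (-n.1)))
          ((map_continuous (mFourier j)).integrable_of_hasCompactSupport
            (HasCompactSupport.of_compactSpace _))), h3, sub_zero]
    have h5 : ∑' n : {n // n ≠ j}, ‖inner ℂ (T n x) (synth T x c)‖ ^ 2 ≤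
        ∫ t, ‖trigPoly c t * φ t - mFourier j t‖ ^ 2 := by
      rw [← hs.tsum_eq]
      simp only [← hcoeff]
      exact hs.summable.tsum_subtype_le _ _ fun n => by positivity
    have h6 : ∫ t, ‖trigPoly c t * φ t - mFourier j t‖ ^ 2 ≤
        ∫ t, B ^ 2 * ‖trigPoly c t - ψ t‖ ^ 2 := by
      refine integral_mono_ae (hm.integrable_norm_pow (by norm_num))
        ((((hp c).sub hψ).integrable_norm_pow (by norm_num)).const_mul _) ?_
      filter_upwards [hnorm] with t ht
      have h0 : φ t ≠ 0 := norm_pos_iff.1 (hA.trans_le ht.1)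
      have : trigPoly c t * φ t - mFourier j t = φ t * (trigPoly c t - ψ t) := by
        simp only [ψ]
        field_simp
      rw [this, norm_mul, mul_pow]
      gcongr
      exact ht.2
    have h7 : A * ∫ t, ‖trigPoly c t‖ ^ 2 ≤ ‖synth T x c‖ ^ 2 := by
      rw [← h.integral_norm_sq_mul_re hT c, ← integral_const_mul]
      refine integral_mono_ae (((hp c).integrable_norm_pow (by norm_num)).const_mul _) ?_ ?_
      · have := (integrable_continuous_mul (g := fun t => ((‖trigPoly c t‖ ^ 2 : ℝ) : ℂ))
          (by fun_prop) h.integrable).re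
        simpa only [RCLike.re_to_complex, Complex.re_ofReal_mul] using this
      · filter_upwards [hge] with t ht
        rw [mul_comm]
        gcongr
    rw [← MemLp.toLp_sub, norm_sq_toLp, norm_sq_toLp, ← integral_const_mul (B ^ 2)]
    calc A' * A * ∫ t, ‖trigPoly c t‖ ^ 2 ≤ A' * ‖synth T x c‖ ^ 2 := by
          rw [mul_assoc]; gcongr
      _ ≤ _ := (hfr c).trans (h5.trans h6)
  have hdense : hψ.toLp ∈
      (Submodule.span ℂ (Set.range (mFourierLp (d := ι) 2))).topologicalClosure := by
    rw [span_mFourierLp_closure_eq_top (by norm_num)]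
    trivial
  have hsub : (Submodule.span ℂ (Set.range (mFourierLp (d := ι) 2)) : Set _) ⊆
      {m | A' * A * ‖m‖ ^ 2 ≤ B ^ 2 * ‖m - hψ.toLp‖ ^ 2} := by
    intro m hm
    rw [← Finsupp.range_linearCombination] at hm
    obtain ⟨c, rfl⟩ := hm
    have e : Finsupp.linearCombination ℂ (mFourierLp (d := ι) 2) c = (hp c).toLp := by
      have e1 : Finsupp.linearCombination ℂ (mFourierLp (d := ι) 2) c =
          ContinuousMap.toLp (E := ℂ) 2 volume ℂ (trigPoly c) := by
        rw [trigPoly, Finsupp.linearCombination_apply, Finsupp.linearCombination_apply,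
          Finsupp.sum, Finsupp.sum, map_sum]
        simp only [map_smul]
      rw [e1]
      exact Lp.ext ((ContinuousMap.coeFn_toLp volume _).trans (hp c).coeFn_toLp.symm)
    simp only [Set.mem_ofPred_eq, e]
    exact key c
  have hcl : IsClosed {m : Lp ℂ 2 (volume : Measure (UnitAddTorus ι)) |
      A' * A * ‖m‖ ^ 2 ≤ B ^ 2 * ‖m - hψ.toLp‖ ^ 2} :=
    isClosed_le (by fun_prop) (by fun_prop)
  have h8 := closure_minimal hsub hcl hdense
  simp only [Set.mem_ofPred_eq, sub_self, norm_zero, ne_eq, OfNat.ofNat_ne_zero,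
    not_false_eq_true, zero_pow, mul_zero] at h8
  have h9 : ‖hψ.toLp‖ ^ 2 = 0 := by
    have : 0 < A' * A := by positivity
    nlinarith [sq_nonneg ‖hψ.toLp‖]
  have h10 : ψ =ᵐ[volume] 0 := by
    rw [← hψ.toLp_eq_toLp_iff MemLp.zero, MemLp.toLp_zero]
    exact norm_eq_zero.1 (pow_eq_zero_iff (by norm_num) |>.1 h9)
  obtain ⟨t, ht1, ht2⟩ := (h10.and hnorm).exists
  have h0 : φ t ≠ 0 := norm_pos_iff.1 (hA.trans_le ht2.1)
  have : ‖ψ t‖ = ‖φ t‖⁻¹ := by simp [ψ, norm_mFourier_apply]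
  rw [ht1] at this
  exact h0 (norm_eq_zero.1 (by simpa using this.symm))

lemma sub_smul (hT : IsShift T) (hx : HasSpectralDensity T x x φ)
    (hy : HasSpectralDensity T y y χ) (hxy : HasSpectralDensity T x y ω) (a : ℝ) :
    HasSpectralDensity T (x - (a : ℂ) • y) (x - (a : ℂ) • y)
      (fun t => φ t - a * (ω t + starRingEnd ℂ (ω t)) + (a : ℂ) ^ 2 * χ t) := by
  have hc : Integrable fun t => starRingEnd ℂ (ω t) :=
    (LinearIsometryEquiv.integrable_comp_iff Complex.conjLIE).2 hxy.integrable
  have hyx : ∀ n, inner ℂ (T n y) x = starRingEnd ℂ (inner ℂ (T (-n) x) y) := fun n => by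
    rw [inner_conj_symm]
    conv_rhs => rw [← hT.zero_apply y]
    rw [hT.inner_apply, zero_sub, neg_neg]
  refine ⟨(hx.integrable.sub ((hxy.integrable.add hc).const_mul _)).add
    (hy.integrable.const_mul _), fun n => ?_⟩
  have hi : ∀ {g : UnitAddTorus ι → ℂ}, Integrable g →
      Integrable fun t => mFourier (-n) t * g t :=
    fun hg => integrable_continuous_mul (map_continuous _) hg
  have e : mFourierCoeff (fun t => φ t - a * (ω t + starRingEnd ℂ (ω t)) + (a : ℂ) ^ 2 * χ t) n =
      mFourierCoeff φ n - a * (mFourierCoeff ω n + mFourierCoeff (fun t => starRingEnd ℂ (ω t)) n)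
        + (a : ℂ) ^ 2 * mFourierCoeff χ n := by
    simp only [mFourierCoeff, smul_eq_mul]
    have h3 := (hi hxy.integrable).add (hi hc)
    have h4 := (hi hx.integrable).sub (h3.const_mul (a : ℂ))
    have h5 := (hi hy.integrable).const_mul ((a : ℂ) ^ 2)
    have h6 := integral_add h4 h5
    simp only [Pi.sub_apply, Pi.add_apply] at h6
    have h7 := integral_sub (hi hx.integrable) (h3.const_mul (a : ℂ))
    simp only [Pi.add_apply] at h7
    rw [h7, integral_const_mul, integral_const_mul, integral_add (hi hxy.integrable) (hi hc)] at h6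
    rw [← h6]
    refine integral_congr_ae (Eventually.of_forall fun t => ?_)
    simp only
    ring
  rw [e, mFourierCoeff_conj, hx.coeff, hy.coeff, hxy.coeff, hxy.coeff, ← hyx]
  simp only [map_sub, map_smul, inner_sub_left, inner_sub_right, inner_smul_left,
    inner_smul_right, Complex.conj_ofReal]
  ring

/-- Where the spectral density of `y` vanishes, that of `x` is at most twice that of `x - y`, by
the parallelogram law; the integral of the latter is `‖x - y‖²`. -/
lemma mul_measureReal_le (hT : IsShift T) (hx : HasSpectralDensity T x x φ)
    (hy : HasSpectralDensity T y y χ) (hxy : HasSpectralDensity T x y ω) {A : ℝ} :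
    A * volume.real {t | A ≤ (φ t).re ∧ (χ t).re = 0} ≤ 2 * ‖x - y‖ ^ 2 := by
  by_cases hA0 : A ≤ 0
  · exact (mul_nonpos_of_nonpos_of_nonneg hA0 measureReal_nonneg).trans (by positivity)
  have h1 := hx.sub_smul hT hy hxy 1
  have h2 := hx.sub_smul hT hy hxy 2
  set w : UnitAddTorus ι → ℂ :=
    fun t => φ t - (1 : ℝ) * (ω t + starRingEnd ℂ (ω t)) + ((1 : ℝ) : ℂ) ^ 2 * χ t with hw
  have hnn := h1.ae_nonneg hT
  have hint : ∫ t, 2 * (w t).re = 2 * ‖x - y‖ ^ 2 := by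
    have := congrArg RCLike.re (h1.integral_eq hT)
    rw [← integral_re h1.integrable, inner_self_eq_norm_sq] at this
    rw [integral_const_mul]
    simpa using this
  rw [← hint]
  have hsub : {t | A ≤ (φ t).re ∧ (χ t).re = 0} ≤ᵐ[volume] {t | A ≤ 2 * (w t).re} := by
    filter_upwards [h2.ae_nonneg hT] with t ht2 ht
    change A ≤ 2 * (w t).re
    have h3 : A ≤ (φ t).re ∧ (χ t).re = 0 := ht
    have h4 := ht2.2
    simp only [hw, Complex.add_re, Complex.sub_re, Complex.re_ofReal_mul, Complex.conj_re,
      ← Complex.ofReal_pow] at h4 ⊢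
    linarith
  refine le_trans ?_ (mul_meas_ge_le_integral_of_nonneg (ε := A) ?_
    (h1.integrable.re.const_mul 2))
  · exact mul_le_mul_of_nonneg_left (ENNReal.toReal_mono (measure_ne_top _ _)
      (measure_mono_ae hsub)) (not_le.1 hA0).le
  · filter_upwards [hnn] with t ht
    have := ht.2
    simp only [Pi.zero_apply, RCLike.re_to_complex]
    positivity

end HasSpectralDensity

/-- The orbit of `f ≠ 0` cannot be a frame with a redundant member if `f` is well approximated by
vectors `g θ` whose spectral density is that of `f` translated by `θ`. The set where the density of
`f` is at least `A` would be invariant under all translations, hence null, contradicting `f ≠ 0`,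
or of full measure, contradicting redundancy. -/
theorem false_of_redundant_frame {T : (ι → ℤ) → H →ₗ[ℂ] H} (hT : IsShift T) {f : H} (hf : f ≠ 0)
    (hbessel : ∀ g, Summable fun n => ‖inner ℂ (T n f) g‖ ^ 2)
    {A B A' : ℝ} (hA : 0 < A) (hB : 0 ≤ B) (hA' : 0 < A') (j : ι → ℤ)
    (hlower : ∀ c, A * ‖synth T f c‖ ^ 2 ≤ ∑' n, ‖inner ℂ (T n f) (synth T f c)‖ ^ 2)
    (hupper : ∀ c, ∑' n, ‖inner ℂ (T n f) (synth T f c)‖ ^ 2 ≤ B * ‖synth T f c‖ ^ 2)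
    (hred : ∀ c, A' * ‖synth T f c‖ ^ 2 ≤
      ∑' n : {n // n ≠ j}, ‖inner ℂ (T n f) (synth T f c)‖ ^ 2)
    (g : (ι → ℝ) → H)
    (hg : ∀ θ n, inner ℂ (T n (g θ)) (g θ) =
      mFourier n (fun i => (θ i : UnitAddCircle)) * inner ℂ (T n f) f)
    (hlim : ∀ θ : ι → ℝ, Tendsto (fun n : ℕ => (n : ℝ) * ‖f - g (fun i => θ i / n)‖ ^ 2)
      atTop (𝓝 0)) : False := by
  obtain ⟨φ, hφm, hφ2, hφ⟩ := exists_hasSpectralDensity (hbessel f)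
  have hdich := hφ.ae_eq_zero_or_le hT hφ2 hlower
  have hle := hφ.ae_le hT hφ2 hB hupper
  let E : Set (UnitAddTorus ι) := {t | A ≤ (φ t).re}
  have hE : MeasurableSet E := measurableSet_le measurable_const
    (Complex.measurable_re.comp hφm)
  have hbound : ∀ θ : ι → ℝ, volume.real
      (E \ (· + fun i => ((θ i : ℝ) : UnitAddCircle)) ⁻¹' E) ≤ 2 / A * ‖f - g θ‖ ^ 2 := by
    intro θ
    set τ : UnitAddTorus ι := fun i => ((θ i : ℝ) : UnitAddCircle) with hτ
    have hmp := measurePreserving_add_right (volume : Measure (UnitAddTorus ι)) τ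
    obtain ⟨ω, -, -, hω⟩ := exists_hasSpectralDensity (hbessel (g θ))
    have hχ : HasSpectralDensity T (g θ) (g θ) (fun t => φ (t + τ)) :=
      ⟨hmp.integrable_comp_of_integrable hφ.integrable, fun n => by
        rw [mFourierCoeff_add_right, hφ.coeff, hg]⟩
    have h1 := hφ.mul_measureReal_le hT hχ hω (A := A)
    have h2 : (E \ (· + τ) ⁻¹' E : Set _) ≤ᵐ[volume]
        {t | A ≤ (φ t).re ∧ (φ (t + τ)).re = 0} := by
      filter_upwards [hmp.quasiMeasurePreserving.ae hdich] with t ht hmem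
      exact ⟨hmem.1, ht.resolve_right hmem.2⟩
    have h3 : volume.real (E \ (· + τ) ⁻¹' E) ≤
        volume.real {t | A ≤ (φ t).re ∧ (φ (t + τ)).re = 0} :=
      ENNReal.toReal_mono (measure_ne_top _ _) (measure_mono_ae h2)
    rw [div_mul_eq_mul_div, le_div_iff₀ hA, mul_comm _ A]
    exact (mul_le_mul_of_nonneg_left h3 hA.le).trans h1
  have hinv : volume E = 0 ∨ volume Eᶜ = 0 := by
    refine measure_eq_zero_or_of_isLittleO hE fun θ => ?_
    refine squeeze_zero (fun n => by positivity) (fun n => ?_)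
      (by simpa using (hlim θ).const_mul (2 / A))
    calc _ ≤ (n : ℝ) * (2 / A * ‖f - g (fun i => θ i / n)‖ ^ 2) := by
          gcongr
          exact hbound fun i => θ i / n
      _ = _ := by ring
  rcases hinv with h0 | h0
  · have h1 : ∀ᵐ t, φ t = 0 := by
      filter_upwards [hdich, hφ.ae_nonneg hT, measure_eq_zero_iff_ae_notMem.1 h0] with t h1 h2 h3
      rw [h2.1, h1.resolve_right h3, Complex.ofReal_zero]
    have h2 := hφ.integral_eq hT
    rw [integral_congr_ae h1, integral_zero] at h2
    exact hf (inner_self_eq_zero.1 h2.symm)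
  · refine hφ.not_frame_compl_singleton hT hφ2 hA hA' ?_ hle j hred
    exact ae_iff.2 h0

/-- The upper frame inequality for a closed subspace controls the correlations with all vectors,
not only with those in the subspace. -/
lemma IsFrameFor.summable {H : Type*} [NormedAddCommGroup H] [InnerProductSpace ℂ H]
    [CompleteSpace H] {κ : Type*} {h : κ → H} {V : Submodule ℂ H} (hV : IsClosed (V : Set H))
    (hf : IsFrameFor h V) (g : H) : Summable fun i => ‖inner ℂ (h i) g‖ ^ 2 := by
  obtain ⟨hmem, A, B, -, -, hAB⟩ := hf
  have : CompleteSpace V := hV.completeSpace_coe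
  have h1 := (hAB _ (V.starProjection_apply_mem g)).1
  have h2 : ∀ i, inner ℂ (h i) (V.starProjection g) = inner ℂ (h i) g := fun i => by
    rw [← Submodule.inner_starProjection_left_eq_right,
      Submodule.starProjection_eq_self_iff.2 (hmem i)]
  simpa only [h2] using h1

/-- `false_of_redundant_frame` for a frame that is not a Riesz basis. -/
theorem false_of_isFrameFor_of_not_isRieszBasisFor {ι : Type*} [Fintype ι] {H : Type*}
    [NormedAddCommGroup H] [InnerProductSpace ℂ H] [CompleteSpace H]
    {T : (ι → ℤ) → H →ₗ[ℂ] H} (hT : IsShift T) {f : H} (hf : f ≠ 0) {κ : Type*}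
    (e : (ι → ℤ) ≃ κ) {h : κ → H} (hTh : ∀ n, T n f = h (e n)) {V : Submodule ℂ H}
    (hV : IsClosed (V : Set H)) (hframe : IsFrameFor h V) (hriesz : ¬ IsRieszBasisFor h V)
    (g : (ι → ℝ) → H)
    (hg : ∀ θ n, inner ℂ (T n (g θ)) (g θ) =
      mFourier n (fun i => (θ i : UnitAddCircle)) * inner ℂ (T n f) f)
    (hlim : ∀ θ : ι → ℝ, Tendsto (fun n : ℕ => (n : ℝ) * ‖f - g (fun i => θ i / n)‖ ^ 2)
      atTop (𝓝 0)) : False := by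
  have hred : ∃ j, IsFrameFor (fun i : {i : κ // i ≠ j} => h i) V := by
    by_contra! hno
    exact hriesz ⟨hframe, hno⟩
  obtain ⟨j, -, A', B', hA', -, hj⟩ := hred
  have hsum := hframe.summable hV
  obtain ⟨hmem, A, B, hA, hAB, hAB'⟩ := hframe
  have hsynth : ∀ c, synth T f c ∈ V := fun c => by
    rw [synth, Finsupp.linearCombination_apply]
    exact Submodule.sum_mem _ fun n _ => Submodule.smul_mem _ _ (hTh n ▸ hmem (e n))
  have htsum : ∀ g, ∑' n, ‖inner ℂ (T n f) g‖ ^ 2 = ∑' i, ‖inner ℂ (h i) g‖ ^ 2 := fun g => by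
    simp only [hTh]
    exact e.tsum_eq fun i => ‖inner ℂ (h i) g‖ ^ 2
  let e' : {n // n ≠ e.symm j} ≃ {i : κ // i ≠ j} :=
    e.subtypeEquiv fun n => by simp [Equiv.eq_symm_apply]
  have htsum' : ∀ g, ∑' n : {n // n ≠ e.symm j}, ‖inner ℂ (T n f) g‖ ^ 2 =
      ∑' i : {i : κ // i ≠ j}, ‖inner ℂ (h i) g‖ ^ 2 := fun g => by
    simp only [hTh]
    exact e'.tsum_eq fun i => ‖inner ℂ (h i.1) g‖ ^ 2
  refine false_of_redundant_frame hT hf (fun g => ?_) hA (hA.le.trans hAB) hA' (e.symm j)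
    (fun c => ?_) (fun c => ?_) (fun c => ?_) g hg hlim
  · simp only [hTh]
    exact e.summable_iff.2 (hsum g)
  · rw [htsum]
    exact (hAB' _ (hsynth c)).2.1
  · rw [htsum]
    exact (hAB' _ (hsynth c)).2.2
  · rw [htsum']
    exact (hj _ (hsynth c)).2.1

end Perturbation

/-! ### Translations and modulations on `L²(ℝᵈ)` -/

section Euclidean

open scoped Real FourierTransform

variable {d : ℕ}

local notation "𝔼" => EuclideanSpace ℝ (Fin d)

lemma coeFn_translate (a : 𝔼) (f : L2 d) : translate a f =ᵐ[volume] fun x => f (x - a) :=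
  Lp.coeFn_compMeasurePreserving f (measurePreserving_sub_right volume a)

lemma translate_translate (a b : 𝔼) (f : L2 d) :
    translate a (translate b f) = translate (a + b) f := by
  refine Lp.ext ((coeFn_translate a _).trans (EventuallyEq.trans ?_ (coeFn_translate _ f).symm))
  filter_upwards [(measurePreserving_sub_right volume a).quasiMeasurePreserving.ae
    (coeFn_translate b f)] with x hx
  rw [hx, sub_sub]

lemma translate_zero (f : L2 d) : translate 0 f = f := by
  refine Lp.ext ((coeFn_translate 0 _).trans ?_)
  simp

lemma inner_translate_translate (a : 𝔼) (f g : L2 d) :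
    inner ℂ (translate a f) (translate a g) = inner ℂ f g :=
  (Lp.compMeasurePreservingₗᵢ ℂ (fun x => x - a)
    (measurePreserving_sub_right volume a)).inner_map_map f g

lemma memLp_fourierChar_mul (u : 𝔼 →ₗ[ℝ] ℝ) (f : L2 d) :
    MemLp (fun x => (𝐞 (u x) : ℂ) * f x) 2 := by
  refine (Lp.memLp f).congr_norm ?_ (Eventually.of_forall fun x => by
    rw [norm_mul, Circle.norm_coe, one_mul])
  have hu : Continuous u := u.continuous_of_finiteDimensional
  exact (Continuous.aestronglyMeasurable
    (continuous_subtype_val.comp (Real.continuous_fourierChar.comp hu))).mul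
      (Lp.aestronglyMeasurable f)

/-- The modulation `x ↦ exp (2 π i u(x)) f(x)` of `f` by a linear functional `u`. -/
noncomputable def modulate (u : 𝔼 →ₗ[ℝ] ℝ) (f : L2 d) : L2 d :=
  (memLp_fourierChar_mul u f).toLp

lemma coeFn_modulate (u : 𝔼 →ₗ[ℝ] ℝ) (f : L2 d) :
    modulate u f =ᵐ[volume] fun x => (𝐞 (u x) : ℂ) * f x :=
  (memLp_fourierChar_mul u f).coeFn_toLp

lemma inner_translate_modulate (u : 𝔼 →ₗ[ℝ] ℝ) (a : 𝔼) (f : L2 d) :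
    inner ℂ (translate a (modulate u f)) (modulate u f) =
      (𝐞 (u a) : ℂ) * inner ℂ (translate a f) f := by
  rw [L2.inner_def, L2.inner_def, ← integral_const_mul]
  refine integral_congr_ae ?_
  filter_upwards [coeFn_translate a (modulate u f), coeFn_translate a f, coeFn_modulate u f,
    (measurePreserving_sub_right volume a).quasiMeasurePreserving.ae (coeFn_modulate u f)]
    with x h1 h2 h3 h4
  rw [h1, h2, h3, h4]
  have h5 : (𝐞 (u x) : ℂ) = (𝐞 (u a) : ℂ) * (𝐞 (u (x - a)) : ℂ) := by
    rw [← Circle.coe_mul, ← AddChar.map_add_eq_mul, map_sub, add_sub_cancel]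
  have h6 : (𝐞 (u (x - a)) : ℂ) * starRingEnd ℂ (𝐞 (u (x - a)) : ℂ) = 1 := by
    rw [Complex.mul_conj', Circle.norm_coe]
    simp
  simp only [RCLike.inner_apply, map_mul]
  rw [h5]
  linear_combination ((𝐞 (u a) : ℂ) * f x * starRingEnd ℂ (f (x - a))) * h6

lemma norm_one_sub_fourierChar_le (r : ℝ) : ‖1 - (𝐞 r : ℂ)‖ ≤ 2 * π * |r| := by
  rw [norm_sub_rev, Real.fourierChar_apply]
  have := Real.norm_exp_I_mul_ofReal_sub_one_le (x := 2 * π * r)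
  rw [mul_comm Complex.I] at this
  refine this.trans_eq ?_
  rw [Real.norm_eq_abs, abs_mul, abs_of_pos (by positivity)]

lemma norm_one_sub_fourierChar_le_two (r : ℝ) : ‖1 - (𝐞 r : ℂ)‖ ≤ 2 := by
  refine (norm_sub_le _ _).trans_eq ?_
  simp only [norm_one, Circle.norm_coe]
  norm_num

/-- If `∫ |x| |f|² < ∞` then `‖f - e^{2πi u / n} f‖² = o(1 / n)`, by dominated convergence:
`n |1 - e^{2πi s / n}|²` tends to `0` and is at most `4 π |s|`. -/
lemma tendsto_mul_norm_sub_modulate (f : L2 d) (hf : Integrable fun x => ‖x‖ * ‖f x‖ ^ 2)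
    (u : 𝔼 →ₗ[ℝ] ℝ) :
    Tendsto (fun n : ℕ => (n : ℝ) * ‖f - modulate ((n : ℝ)⁻¹ • u) f‖ ^ 2) atTop (𝓝 0) := by
  have hu : Continuous u := u.continuous_of_finiteDimensional
  have hnorm : ∀ n : ℕ, (n : ℝ) * ‖f - modulate ((n : ℝ)⁻¹ • u) f‖ ^ 2 =
      ∫ x, (n : ℝ) * ‖1 - (𝐞 ((n : ℝ)⁻¹ * u x) : ℂ)‖ ^ 2 * ‖f x‖ ^ 2 := by
    intro n
    have h1 : ‖f - modulate ((n : ℝ)⁻¹ • u) f‖ ^ 2 =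
        ∫ x, ‖(f - modulate ((n : ℝ)⁻¹ • u) f : L2 d) x‖ ^ 2 := by
      rw [← norm_sq_toLp (Lp.memLp _), Lp.toLp_coeFn]
    rw [h1, ← integral_const_mul]
    refine integral_congr_ae ?_
    filter_upwards [Lp.coeFn_sub f (modulate ((n : ℝ)⁻¹ • u) f),
      coeFn_modulate ((n : ℝ)⁻¹ • u) f] with x h2 h3
    rw [h2, Pi.sub_apply, h3, LinearMap.smul_apply, smul_eq_mul, mul_assoc, ← mul_pow,
      ← norm_mul, sub_mul, one_mul]
  simp only [hnorm]
  have hzero : (0 : ℝ) = ∫ x : 𝔼, (0 : ℝ) := by simp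
  rw [hzero]
  let C := ‖u.toContinuousLinearMap‖
  have hC : ∀ x, |u x| ≤ C * ‖x‖ := fun x => u.toContinuousLinearMap.le_opNorm x
  refine tendsto_integral_of_dominated_convergence
    (fun x => 4 * π * C * (‖x‖ * ‖f x‖ ^ 2)) (fun n => ?_) (hf.const_mul _) (fun n => ?_) ?_
  · have h1 : Continuous fun x => (n : ℝ) * ‖1 - (𝐞 ((n : ℝ)⁻¹ * u x) : ℂ)‖ ^ 2 :=
      continuous_const.mul ((continuous_const.sub (continuous_subtype_val.comp
        (Real.continuous_fourierChar.comp (continuous_const.mul hu)))).norm.pow 2)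
    exact h1.aestronglyMeasurable.mul ((Lp.aestronglyMeasurable f).norm.pow 2)
  · refine Eventually.of_forall fun x => ?_
    rw [Real.norm_of_nonneg (by positivity), ← mul_assoc]
    refine mul_le_mul_of_nonneg_right ?_ (sq_nonneg _)
    rcases Nat.eq_zero_or_pos n with rfl | hn
    · simp only [Nat.cast_zero, zero_mul]
      positivity
    · have hn' : (0 : ℝ) < n := by exact_mod_cast hn
      calc (n : ℝ) * ‖1 - (𝐞 ((n : ℝ)⁻¹ * u x) : ℂ)‖ ^ 2
          ≤ n * (2 * (2 * π * |(n : ℝ)⁻¹ * u x|)) := by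
            rw [pow_two]
            gcongr
            · exact norm_one_sub_fourierChar_le_two _
            · exact norm_one_sub_fourierChar_le _
        _ = 4 * π * |u x| := by
            rw [abs_mul, abs_of_pos (inv_pos.2 hn')]
            field_simp
            ring
        _ ≤ 4 * π * (C * ‖x‖) := by
            gcongr
            exact hC x
        _ = 4 * π * C * ‖x‖ := by ring
  · refine Eventually.of_forall fun x => ?_
    have h1 : Tendsto (fun n : ℕ => (2 * π * |u x|) ^ 2 * ‖f x‖ ^ 2 * (n : ℝ)⁻¹) atTop (𝓝 0) := by
      have := (tendsto_inv_atTop_nhds_zero_nat (𝕜 := ℝ)).const_mul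
        ((2 * π * |u x|) ^ 2 * ‖f x‖ ^ 2)
      rwa [mul_zero] at this
    refine squeeze_zero (fun n => by positivity) (fun n => ?_) h1
    rcases Nat.eq_zero_or_pos n with rfl | hn
    · simp
    · have hn' : (0 : ℝ) < n := by exact_mod_cast hn
      calc (n : ℝ) * ‖1 - (𝐞 ((n : ℝ)⁻¹ * u x) : ℂ)‖ ^ 2 * ‖f x‖ ^ 2
          ≤ n * (2 * π * |(n : ℝ)⁻¹ * u x|) ^ 2 * ‖f x‖ ^ 2 := by
            gcongr
            exact norm_one_sub_fourierChar_le _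
        _ = _ := by
            rw [abs_mul, abs_of_pos (inv_pos.2 hn')]
            field_simp

/-- The translation operator as a linear map. -/
noncomputable def translateLinear (a : 𝔼) : L2 d →ₗ[ℂ] L2 d :=
  (Lp.compMeasurePreservingₗᵢ ℂ (fun x => x - a)
    (measurePreserving_sub_right volume a)).toLinearMap

lemma translateLinear_apply (a : 𝔼) (f : L2 d) : translateLinear a f = translate a f := rfl

lemma isShift_translateLinear {ι : Type*} [Fintype ι] (e : (ι → ℤ) →+ 𝔼) :
    IsShift fun n => translateLinear (e n) := by
  refine ⟨fun x => ?_, fun m n x y => ?_⟩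
  · rw [translateLinear_apply, map_zero, translate_zero]
  · simp only [translateLinear_apply]
    rw [← inner_translate_translate (e n) _ y, translate_translate, map_sub, add_sub_cancel]

lemma fourierChar_sum {ι : Type*} [Fintype ι] (n : ι → ℤ) (θ : ι → ℝ) :
    (𝐞 (∑ i, n i * θ i) : ℂ) = mFourier n (fun i => (θ i : UnitAddCircle)) := by
  rw [Real.fourierChar_apply]
  simp only [mFourier, ContinuousMap.coe_mk, fourier_coe_apply]
  rw [← Complex.exp_sum]
  congr 1
  push_cast
  rw [Finset.mul_sum, Finset.sum_mul]
  refine Finset.sum_congr rfl fun i _ => ?_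
  ring

/-- If the translates of `f ≠ 0` along a lattice form a frame for their closed span that is not a
Riesz basis, then `∫ |x| |f|² = ∞`. -/
theorem lintegral_norm_mul_sq_eq_top (L : Submodule ℤ 𝔼) [DiscreteTopology L] [IsZLattice ℝ L]
    {ι : Type*} [Fintype ι] (b : Module.Basis ι ℤ L) (f : L2 d) (hf : f ≠ 0)
    (hframe : IsFrameFor (translates L f) (shiftSpace L f))
    (hriesz : ¬ IsRieszBasisFor (translates L f) (shiftSpace L f)) :
    ∫⁻ x, ENNReal.ofReal (‖x‖ * ‖f x‖ ^ 2) = ⊤ := by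
  by_contra hfin
  have hint : Integrable fun x => ‖x‖ * ‖f x‖ ^ 2 := by
    refine ⟨continuous_norm.aestronglyMeasurable.mul ((Lp.aestronglyMeasurable f).norm.pow 2), ?_⟩
    rw [hasFiniteIntegral_iff_ofReal (Eventually.of_forall fun x => by positivity)]
    exact lt_top_iff_ne_top.2 hfin
  -- The functional `x ↦ ∑ θᵢ xᵢ` in the coordinates given by the basis of the lattice.
  obtain ⟨u, hu⟩ : ∃ u : (ι → ℝ) →ₗ[ℝ] 𝔼 →ₗ[ℝ] ℝ, ∀ θ i, u θ (b i) = θ i :=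
    ⟨((b.ofZLatticeBasis ℝ L).constr ℝ).toLinearMap, fun θ i => by
      rw [← b.ofZLatticeBasis_apply ℝ L]
      exact Module.Basis.constr_basis _ _ _ _⟩
  have hue : ∀ θ n, u θ (b.equivFun.symm n : L) = ∑ i, n i * θ i := fun θ n => by
    simp only [Module.Basis.equivFun_symm_apply, Submodule.coe_sum, Submodule.coe_smul, map_sum,
      map_zsmul, hu, zsmul_eq_mul]
  refine false_of_isFrameFor_of_not_isRieszBasisFor
    (isShift_translateLinear ((L.subtype ∘ₗ b.equivFun.symm.toLinearMap).toAddMonoidHom))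
    hf b.equivFun.symm.toEquiv (fun n => rfl) (Submodule.isClosed_topologicalClosure _)
    hframe hriesz (fun θ => modulate (u θ) f) (fun θ n => ?_) (fun θ => ?_)
  · rw [translateLinear_apply, translateLinear_apply, inner_translate_modulate, ← fourierChar_sum,
      ← hue]
    rfl
  · have h1 : ∀ n : ℕ, u (fun i => θ i / n) = (n : ℝ)⁻¹ • u θ := fun n => by
      rw [← map_smul]
      congr 1
      funext i
      simp [div_eq_inv_mul]
    simp only [h1]
    exact tendsto_mul_norm_sub_modulate f hint (u θ)

end Euclidean

/-! ### The Sobolev condition -/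

section Sobolev

open scoped FourierTransform SchwartzMap ContDiff
open TemperedDistribution

variable {d : ℕ}

local notation "𝔼" => EuclideanSpace ℝ (Fin d)

/-- Two-fold Fourier transformation is reflection. -/
lemma fourier_fourier_schwartz (v : 𝓢(𝔼, ℂ)) (x : 𝔼) : 𝓕 (𝓕 v) x = v (-x) := by
  have h : 𝓕⁻ (𝓕 v) (-x) = v (-x) := by rw [FourierTransform.fourierInv_fourier_eq]
  rw [SchwartzMap.fourierInv_apply_eq] at h
  simpa using h

/-- If the Fourier transform of `f` is in the Sobolev space `H^{1/2}`, then `∫ |x| |f|² < ∞`: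
since `𝓕 𝓕 f = f (-·)`, the Sobolev condition says that `(1 + |x|²)^{1/4} f(-x)` is in `L²`. -/
theorem lintegral_ne_top_of_memSobolev (f : L2 d)
    (h : MemSobolev (1 / 2 : ℝ) 2 ((𝓕 f : L2 d) : 𝓢'(𝔼, ℂ))) :
    ∫⁻ x, ENNReal.ofReal (‖x‖ * ‖f x‖ ^ 2) ≠ ⊤ := by
  obtain ⟨g, hg⟩ := memSobolev_iff_exists_smulLeftCLM_fourier.1 h
  let m : 𝔼 → ℝ := fun x => (1 + ‖x‖ ^ 2) ^ ((1 / 2 : ℝ) / 2)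
  have hm : Continuous m := by
    refine Continuous.rpow_const (by fun_prop) fun x => Or.inl (by positivity)
  have hmt : (fun x : 𝔼 => ((m x : ℝ) : ℂ)).HasTemperateGrowth := by
    fun_prop
  have hneg := Measure.measurePreserving_neg (volume : Measure 𝔼)
  have hfneg : MemLp (fun x => f (-x)) 2 := (Lp.memLp f).comp_measurePreserving hneg
  have htest : ∀ v : 𝓢(𝔼, ℂ), ∫ x, v x * g x = ∫ x, v x * ((m x : ℂ) * f (-x)) := by
    intro v
    have h1 := congrArg (fun D : 𝓢'(𝔼, ℂ) => D v) hg
    rw [← Lp.fourier_toTemperedDistribution_eq f] at h1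
    simp only [smulLeftCLM_apply_apply, TemperedDistribution.fourier_apply,
      Lp.toTemperedDistribution_apply, fourier_fourier_schwartz, smul_eq_mul] at h1
    rw [← h1, ← integral_neg_eq_self]
    refine integral_congr_ae (Eventually.of_forall fun x => ?_)
    simp only [neg_neg]
    rw [SchwartzMap.smulLeftCLM_apply_apply hmt]
    simp only [smul_eq_mul]
    ring
  have hloc : LocallyIntegrable (fun x => (m x : ℂ) * f (-x)) volume :=
    LocallyIntegrable.continuous_mul (Complex.continuous_ofReal.comp hm)
      (hfneg.locallyIntegrable (by norm_num))
  have hae : ∀ᵐ x, g x = (m x : ℂ) * f (-x) := by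
    refine ae_eq_of_integral_contDiff_smul_eq ((Lp.memLp g).locallyIntegrable (by norm_num)) hloc
      fun v hv hvc => ?_
    have hvc' : HasCompactSupport (Complex.ofRealCLM ∘ v) := hvc.comp_left rfl
    have hv' : ContDiff ℝ ∞ (Complex.ofRealCLM ∘ v) := by fun_prop
    simpa using htest (hvc'.toSchwartzMap hv')
  have hgsq : ∫⁻ x, ENNReal.ofReal (‖g x‖ ^ 2) ≠ ⊤ := by
    have := (Lp.memLp g).integrable_norm_pow (by norm_num)
    exact (this.lintegral_lt_top).ne
  refine ne_top_of_le_ne_top hgsq ?_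
  rw [← hneg.lintegral_comp_emb (MeasurableEquiv.neg 𝔼).measurableEmbedding]
  refine lintegral_mono_ae ?_
  filter_upwards [hae] with x hx
  refine ENNReal.ofReal_le_ofReal ?_
  have h1 : ‖x‖ ≤ m x ^ 2 := by
    have h2 : m x ^ 2 = Real.sqrt (1 + ‖x‖ ^ 2) := by
      rw [Real.sqrt_eq_rpow, ← Real.rpow_natCast, ← Real.rpow_mul (by positivity)]
      norm_num
    rw [h2]
    exact Real.le_sqrt_of_sq_le (by linarith)
  rw [norm_neg, hx, norm_mul, mul_pow, Complex.norm_real, Real.norm_eq_abs, sq_abs]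
  gcongr

end Sobolev

end ShiftInvariant

theorem corollary1p5 {d : ℕ} (L : Submodule ℤ (EuclideanSpace ℝ (Fin d)))
    [DiscreteTopology L] [IsZLattice ℝ L] (f : ShiftInvariant.L2 d) (hf : f ≠ 0)
    (hframe : ShiftInvariant.IsFrameFor (ShiftInvariant.translates L f)
      (ShiftInvariant.shiftSpace L f))
    (hriesz : ¬ ShiftInvariant.IsRieszBasisFor (ShiftInvariant.translates L f)
      (ShiftInvariant.shiftSpace L f)) :
    (∫⁻ x, ENNReal.ofReal (‖x‖ * ‖f x‖ ^ 2) = ⊤) ∧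
      ¬ TemperedDistribution.MemSobolev (1 / 2 : ℝ) 2
        ((FourierTransform.fourier f : ShiftInvariant.L2 d) :
          TemperedDistribution (EuclideanSpace ℝ (Fin d)) ℂ) :=
  have h := ShiftInvariant.lintegral_norm_mul_sq_eq_top L (Module.Free.chooseBasis ℤ L) f hf
    hframe hriesz
  ⟨h, fun hs => ShiftInvariant.lintegral_ne_top_of_memSobolev f hs h⟩
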